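/- Let $V\subset\mathbb R^n$ (row vectors $\xi$) be an open cone, i.e. $tV\subset V$ for all $t>0$ ($V$ is not assumed convex), whose boundary $\partial V$ has Lebesgue measure zero. A pointed convex cone is a convex cone whose closure contains no line. The index of non-convexity $q$ of $V$ is the least codimension of a linear subspace $L\subset\mathbb R^n$ such that some connected component of $L\cap V$ is a pointed convex cone. The pointed convex cones that occur as connected components of $L\cap V$ with $\operatorname{codim}L=q$ are the slices of $V$. Put $\ell=n-q$ and fix a set $\mathcal A$ of slices of $V$. Let $\Xi(V)$ be the set of $\ell$-frames $\Xi=(\xi^1,\dots,\xi^\ell)$ (linearly independent vectors in $\mathbb R^n$, the rows of an $\ell\times n$ matrix) such that $\{\tau\Xi=\sum_j\tau_j\xi^j:\tau_1,\dots,\tau_\ell>0\}$ is contained in a slice from $\mathcal A$; this slice is then unique and is denoted by $v(\Xi)$. For $\Xi\in\Xi(V)$ let $V^*(\Xi)=\{x\in\mathbb R^n:\xi x>0\ \text{ for all }\xi\in\overline{v(\Xi)}\setminus\{0\}\}$, where $\xi x=\sum_k\xi_kx_k$, and $T(\Xi)=\mathbb R^n+iV^*(\Xi)\subset\mathbb C^n$.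 Let $\Phi(\tau,\Xi)=\tau\Xi$. For an $n$-form $\eta$, let $\int_{\{\tau:\tau\Xi\in v(\Xi)\}}\Phi^*\eta$ be the direct image, i.e. the $q$-form in $\Xi$ obtained by integrating over $\tau$ the coefficient of $d\tau_1\wedge\dots\wedge d\tau_\ell$ (written on the left) in $\Phi^*\eta$. Let $\gamma$ be a generating cycle in $\Xi(V)$ with coefficient $c(\gamma)$: $\gamma$ is a singular $q$-cycle with integer coefficients made of $C^1$ simplices with values in $\Xi(V)$, and $c(\gamma)$ is a non-zero integer such that $$\int_\gamma\int_{\{\tau:\tau\Xi\in v(\Xi)\}}\Phi^*\eta=c(\gamma)\int_V\eta$$ for every smooth $n$-form $\eta$ with compact support in $V$. Let $f\in\mathcal S(V)$, i.e. $f$ is a complex-valued Schwartz function on $\mathbb R^n$ with $\operatorname{supp}f\subset\overline V$. Its cohomological Laplace form-transform is the $q$-form $$\tilde{\mathcal L}f(z;\Xi,d\Xi)=\int_{\{\tau:\tau\Xi\in v(\Xi)\}}\Phi^*\bigl(e^{i\xi z}f(\xi)\,d\xi_1\wedge\dots\wedge d\xi_n\bigr)\qquad(\Xi\in\Xi(V),\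 z\in T(\Xi)).$$ **Theorem.** The integral that defines $\tilde{\mathcal L}f(z;\Xi,d\Xi)$ converges absolutely for all $\Xi\in\Xi(V)$ and $z\in T(\Xi)$. For every $x\in\mathbb R^n$ and $\Xi\in\Xi(V)$, the point $x$ lies in the closure of $T(\Xi)$ and the boundary value $$\tilde{\mathcal L}f(x;\Xi,d\Xi)=\lim_{T(\Xi)\ni z\to x}\tilde{\mathcal L}f(z;\Xi,d\Xi)$$ exists. This $q$-form is integrable over $\gamma$, and $$\mathcal Ff(x):=\int_{\mathbb R^n}e^{i\xi x}f(\xi)\,d\xi=\frac1{c(\gamma)}\int_\gamma\tilde{\mathcal L}f(x;\Xi,d\Xi)=:(b\circ\tilde{\mathcal L}f)(x)\qquad(x\in\mathbb R^n).$$ -/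

import Mathlib

open MeasureTheory Filter Topology Set
open scoped SchwartzMap ContDiff

noncomputable section

namespace CohLaplace

/-! ### Cones, slices and frames -/

/-- A pointed convex cone: closed under positive scaling, convex, and with no line in its
closure. -/
def IsPointedConvexCone {n : ℕ} (v : Set (Fin n → ℝ)) : Prop :=
  (∀ t : ℝ, 0 < t → ∀ ξ ∈ v, t • ξ ∈ v) ∧ Convex ℝ v ∧
    ∀ ξ, ξ ∈ closure v → -ξ ∈ closure v → ξ = 0

/-- `v` is a connected component of `L ∩ V` and is a pointed convex cone. -/
def IsPointedComponent {n : ℕ} (V : Set (Fin n → ℝ)) (L : Submodule ℝ (Fin n → ℝ))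
    (v : Set (Fin n → ℝ)) : Prop :=
  (∃ ξ ∈ (L : Set (Fin n → ℝ)) ∩ V, v = connectedComponentIn ((L : Set (Fin n → ℝ)) ∩ V) ξ) ∧
    IsPointedConvexCone v

/-- The index of non-convexity of `V`: the least codimension of a linear subspace `L` such that
some connected component of `L ∩ V` is a pointed convex cone. -/
def nonconvexityIndex {n : ℕ} (V : Set (Fin n → ℝ)) : ℕ :=
  sInf {k : ℕ | ∃ (L : Submodule ℝ (Fin n → ℝ)) (v : Set (Fin n → ℝ)),
    IsPointedComponent V L v ∧ Module.finrank ℝ ((Fin n → ℝ) ⧸ L) = k}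

/-- A slice of `V`: a pointed component of `L ∩ V` with `L` of minimal codimension. -/
def IsSlice {n : ℕ} (V v : Set (Fin n → ℝ)) : Prop :=
  ∃ L : Submodule ℝ (Fin n → ℝ), IsPointedComponent V L v ∧
    Module.finrank ℝ ((Fin n → ℝ) ⧸ L) = nonconvexityIndex V

/-- The map `Φ (τ, Ξ) = τ Ξ = ∑ j, τ_j ξ^j`, where `ξ^1, …, ξ^ℓ` are the rows of `Ξ`. -/
def frameMap {ℓ n : ℕ} (p : (Fin ℓ → ℝ) × (Fin ℓ → Fin n → ℝ)) : Fin n → ℝ :=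
  ∑ j, p.1 j • p.2 j

/-- The positive polyhedral cone spanned by the rows of `Ξ`. -/
def hedron {ℓ n : ℕ} (Ξ : Fin ℓ → Fin n → ℝ) : Set (Fin n → ℝ) :=
  {ξ | ∃ τ : Fin ℓ → ℝ, (∀ j, 0 < τ j) ∧ ξ = frameMap (τ, Ξ)}

/-- The parameter space of a set `A` of slices: the `ℓ`-frames whose positive polyhedral cone is
contained in a slice that belongs to `A`. -/
def paramSpace {n : ℕ} (A : Set (Set (Fin n → ℝ))) (ℓ : ℕ) : Set (Fin ℓ → Fin n → ℝ) :=
  {Ξ | LinearIndependent ℝ Ξ ∧ ∃ v ∈ A, hedron Ξ ⊆ v}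

/-- The slice `v(Ξ)` in `A` that contains the positive polyhedral cone of `Ξ` (for `Ξ` in the
parameter space there is exactly one such slice). -/
def sliceOf {ℓ n : ℕ} (A : Set (Set (Fin n → ℝ))) (Ξ : Fin ℓ → Fin n → ℝ) :
    Set (Fin n → ℝ) :=
  ⋃₀ {v | v ∈ A ∧ hedron Ξ ⊆ v}

/-- The wedge `V*(Ξ)` dual to the slice `v(Ξ)`. -/
def wedge {ℓ n : ℕ} (A : Set (Set (Fin n → ℝ))) (Ξ : Fin ℓ → Fin n → ℝ) :
    Set (Fin n → ℝ) :=
  {x | ∀ ξ ∈ closure (sliceOf A Ξ), ξ ≠ 0 → 0 < ξ ⬝ᵥ x}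

/-- The tube `T(Ξ) = ℝⁿ + i V*(Ξ)`. -/
def tube {ℓ n : ℕ} (A : Set (Set (Fin n → ℝ))) (Ξ : Fin ℓ → Fin n → ℝ) :
    Set (Fin n → ℂ) :=
  {z | (fun k => (z k).im) ∈ wedge A Ξ}

/-- The inclusion of `ℝⁿ` in `ℂⁿ`. -/
def realPoint {n : ℕ} (x : Fin n → ℝ) : Fin n → ℂ := fun k => (x k : ℂ)

/-! ### Singular chains and integration of forms over them -/

/-- Singular `p`-chains with integer coefficients (regularity is imposed in `IsCycleIn`). -/
abbrev Chain (E : Type*) (p : ℕ) : Type _ := (stdSimplex ℝ (Fin (p + 1)) → E) →₀ ℤ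

/-- The boundary of a singular chain. -/
def chainBoundary {E : Type*} {p : ℕ} (γ : Chain E (p + 1)) : Chain E p :=
  γ.sum fun σ m => ∑ i : Fin (p + 2),
    Finsupp.single (fun t => σ (stdSimplex.map i.succAbove t)) ((-1) ^ (i : ℕ) * m)

/-- A chain is closed if its boundary vanishes; every `0`-chain is closed. -/
def IsClosedChain {E : Type*} : {p : ℕ} → Chain E p → Prop
  | 0, _ => True
  | _ + 1, γ => chainBoundary γ = 0

/-- The barycentric coordinates `(1 - ∑ u_i, u_1, …, u_p)`. -/
def baryCoords {p : ℕ} (u : Fin p → ℝ) : Fin (p + 1) → ℝ := Fin.cons (1 - ∑ i, u i) u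

/-- The standard simplex in `ℝᵖ`: all `u_i ≥ 0` and `∑ u_i ≤ 1`. -/
def cornerSimplex (p : ℕ) : Set (Fin p → ℝ) := {u | baryCoords u ∈ stdSimplex ℝ (Fin (p + 1))}

open Classical in
/-- A singular simplex in the coordinates `u` (extended by zero). -/
def inCoords {E : Type*} [Zero E] {p : ℕ} (σ : stdSimplex ℝ (Fin (p + 1)) → E)
    (u : Fin p → ℝ) : E :=
  if h : baryCoords u ∈ stdSimplex ℝ (Fin (p + 1)) then σ ⟨baryCoords u, h⟩ else 0

section Integration

variable {E : Type*} [NormedAddCommGroup E] [NormedSpace ℝ E]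

/-- A `p`-cycle in `X`: a closed singular chain made of continuously differentiable simplices with
values in `X`. -/
def IsCycleIn (X : Set E) {p : ℕ} (γ : Chain E p) : Prop :=
  IsClosedChain γ ∧
    ∀ σ ∈ γ.support, (∀ t, σ t ∈ X) ∧ ContDiffOn ℝ 1 (inCoords σ) (cornerSimplex p)

/-- The coefficient of `du_1 ∧ … ∧ du_p` in the pullback of the `p`-form `θ` by `σ`. -/
def simplexIntegrand {p : ℕ} (θ : E → E [⋀^Fin p]→L[ℝ] ℂ)
    (σ : stdSimplex ℝ (Fin (p + 1)) → E) (u : Fin p → ℝ) : ℂ :=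
  θ (inCoords σ u) fun i =>
    fderivWithin ℝ (inCoords σ) (cornerSimplex p) u (Pi.single i 1)

/-- The form `θ` is integrable over the chain `γ`. -/
def ChainIntegrable {p : ℕ} (γ : Chain E p) (θ : E → E [⋀^Fin p]→L[ℝ] ℂ) : Prop :=
  ∀ σ ∈ γ.support, IntegrableOn (simplexIntegrand θ σ) (cornerSimplex p)

/-- The integral `∫_γ θ` of a `p`-form over a `p`-chain. -/
def chainIntegral {p : ℕ} (γ : Chain E p) (θ : E → E [⋀^Fin p]→L[ℝ] ℂ) : ℂ :=
  γ.sum fun σ m => (m : ℂ) * ∫ u in cornerSimplex p, simplexIntegrand θ σ u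

/-- Insertion of the vectors `e_1, …, e_k` in the first `k` places of a form. -/
def contract {q : ℕ} : (k : ℕ) → (E [⋀^Fin (q + k)]→L[ℝ] ℂ) → (Fin k → E) →
    E [⋀^Fin q]→L[ℝ] ℂ
  | 0, α, _ => α
  | k + 1, α, e => contract k (ContinuousAlternatingMap.curryLeft (n := q + k) α (e 0))
      (Fin.tail e)

end Integration

/-! ### Direct images, and the Laplace form-transform -/

/-- The volume form `dξ_1 ∧ … ∧ dξ_n` with complex values. -/
def volForm (n : ℕ) : (Fin n → ℝ) [⋀^Fin n]→L[ℝ] ℂ :=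
  Complex.ofRealCLM.compContinuousAlternatingMap
    { toAlternatingMap := Matrix.detRowAlternating
      cont := by
        show Continuous fun M : Fin n → Fin n → ℝ => Matrix.det (M : Matrix (Fin n) (Fin n) ℝ)
        exact Continuous.matrix_det continuous_id }

/-- The integral over `V` of an `n`-form on `ℝⁿ` with its standard orientation. -/
def topIntegral {n : ℕ} (V : Set (Fin n → ℝ)) (η : (Fin n → ℝ) → (Fin n → ℝ) [⋀^Fin n]→L[ℝ] ℂ) :
    ℂ :=
  ∫ ξ in V, η ξ fun i => Pi.single i 1

variable {q ℓ : ℕ}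

/-- The pullback `Φ^* η` of an `n`-form, `n = q + ℓ`. -/
def pullbackForm
    (η : (Fin (q + ℓ) → ℝ) → (Fin (q + ℓ) → ℝ) [⋀^Fin (q + ℓ)]→L[ℝ] ℂ)
    (p : (Fin ℓ → ℝ) × (Fin ℓ → Fin (q + ℓ) → ℝ)) :
    ((Fin ℓ → ℝ) × (Fin ℓ → Fin (q + ℓ) → ℝ)) [⋀^Fin (q + ℓ)]→L[ℝ] ℂ :=
  (η (frameMap p)).compContinuousLinearMap (fderiv ℝ frameMap p)

/-- The `q`-form in `Ξ` that is the coefficient of `dτ_1 ∧ … ∧ dτ_ℓ` (written on the left) in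
`Φ^* η`. -/
def fiberIntegrand
    (η : (Fin (q + ℓ) → ℝ) → (Fin (q + ℓ) → ℝ) [⋀^Fin (q + ℓ)]→L[ℝ] ℂ)
    (Ξ : Fin ℓ → Fin (q + ℓ) → ℝ) (τ : Fin ℓ → ℝ) :
    (Fin ℓ → Fin (q + ℓ) → ℝ) [⋀^Fin q]→L[ℝ] ℂ :=
  (contract ℓ (pullbackForm η (τ, Ξ)) fun j => (Pi.single j 1, 0)).compContinuousLinearMap
    (ContinuousLinearMap.inr ℝ (Fin ℓ → ℝ) (Fin ℓ → Fin (q + ℓ) → ℝ))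

/-- The fibre `{τ ; τ Ξ ∈ v(Ξ)}`. -/
def fiber (A : Set (Set (Fin (q + ℓ) → ℝ))) (Ξ : Fin ℓ → Fin (q + ℓ) → ℝ) : Set (Fin ℓ → ℝ) :=
  {τ | frameMap (τ, Ξ) ∈ sliceOf A Ξ}

/-- The direct image: the `q`-form `∫_{τ Ξ ∈ v(Ξ)} Φ^* η` on the parameter space. -/
def fiberIntegral (A : Set (Set (Fin (q + ℓ) → ℝ)))
    (η : (Fin (q + ℓ) → ℝ) → (Fin (q + ℓ) → ℝ) [⋀^Fin (q + ℓ)]→L[ℝ] ℂ)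
    (Ξ : Fin ℓ → Fin (q + ℓ) → ℝ) :
    (Fin ℓ → Fin (q + ℓ) → ℝ) [⋀^Fin q]→L[ℝ] ℂ :=
  ∫ τ in fiber A Ξ, fiberIntegrand η Ξ τ

/-- The oriented union of the slices over the chain `γ` is `V` with the coefficient `c`: the
identity `∫_γ ∫_{τ Ξ ∈ v(Ξ)} Φ^* η = c ∫_V η` holds for all smooth `n`-forms `η` with compact
support in `V`. -/
def HasCoefficient (V : Set (Fin (q + ℓ) → ℝ)) (A : Set (Set (Fin (q + ℓ) → ℝ)))
    (γ : Chain (Fin ℓ → Fin (q + ℓ) → ℝ) q) (c : ℤ) : Prop :=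
  ∀ η : (Fin (q + ℓ) → ℝ) → (Fin (q + ℓ) → ℝ) [⋀^Fin (q + ℓ)]→L[ℝ] ℂ,
    ContDiff ℝ ∞ η → HasCompactSupport η → tsupport η ⊆ V →
      chainIntegral γ (fiberIntegral A η) = (c : ℂ) * topIntegral V η

/-- The `n`-form `e^{i ξ z} f(ξ) dξ_1 ∧ … ∧ dξ_n`. -/
def expForm {n : ℕ} (f : (Fin n → ℝ) → ℂ) (z : Fin n → ℂ) (ξ : Fin n → ℝ) :
    (Fin n → ℝ) [⋀^Fin n]→L[ℝ] ℂ :=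
  (Complex.exp (Complex.I * ∑ k, (ξ k : ℂ) * z k) * f ξ) • volForm n

/-- The cohomological Laplace form-transform of `f`. -/
def laplaceForm (A : Set (Set (Fin (q + ℓ) → ℝ))) (f : (Fin (q + ℓ) → ℝ) → ℂ)
    (z : Fin (q + ℓ) → ℂ) (Ξ : Fin ℓ → Fin (q + ℓ) → ℝ) :
    (Fin ℓ → Fin (q + ℓ) → ℝ) [⋀^Fin q]→L[ℝ] ℂ :=
  fiberIntegral A (expForm f z) Ξ

/-- The boundary value `ψ(x; Ξ, dΞ)` of a form `ψ(z; Ξ, dΞ)` defined for `z ∈ T(Ξ)`: the limit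
as `z → x` in `T(Ξ)`. -/
def boundaryValue (A : Set (Set (Fin (q + ℓ) → ℝ)))
    (ψ : (Fin (q + ℓ) → ℂ) → (Fin ℓ → Fin (q + ℓ) → ℝ) →
      (Fin ℓ → Fin (q + ℓ) → ℝ) [⋀^Fin q]→L[ℝ] ℂ)
    (x : Fin (q + ℓ) → ℝ) (Ξ : Fin ℓ → Fin (q + ℓ) → ℝ) :
    (Fin ℓ → Fin (q + ℓ) → ℝ) [⋀^Fin q]→L[ℝ] ℂ :=
  limUnder (𝓝[tube A Ξ] (realPoint x)) fun z => ψ z Ξ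

/-- The boundary value map `bψ(x) = c(γ)⁻¹ ∫_γ ψ(x; Ξ, dΞ)`. -/
def boundaryMap (A : Set (Set (Fin (q + ℓ) → ℝ)))
    (γ : Chain (Fin ℓ → Fin (q + ℓ) → ℝ) q) (c : ℤ)
    (ψ : (Fin (q + ℓ) → ℂ) → (Fin ℓ → Fin (q + ℓ) → ℝ) →
      (Fin ℓ → Fin (q + ℓ) → ℝ) [⋀^Fin q]→L[ℝ] ℂ)
    (x : Fin (q + ℓ) → ℝ) : ℂ :=
  (c : ℂ)⁻¹ * chainIntegral γ (boundaryValue A ψ x)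

/-- The Fourier transform `∫ e^{i ξ x} f(ξ) dξ`. -/
def fourierInt {n : ℕ} (f : (Fin n → ℝ) → ℂ) (x : Fin n → ℝ) : ℂ :=
  ∫ ξ : Fin n → ℝ, Complex.exp (Complex.I * ((ξ ⬝ᵥ x : ℝ) : ℂ)) * f ξ

end CohLaplace

end

/-!
A cycle `γ` with coefficient `c(γ)` satisfies `∫_γ ∫ Φ^* η = c(γ) ∫_V η` for compactly supported
test forms `η` in `V`. The theorem says that the same identity holds for
`η = e^{i ξ x} f(ξ) dξ_1 ∧ … ∧ dξ_n`, which is smooth and rapidly decreasing but need not vanish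
near `∂V`, and that its left side is the integral of a boundary value from the tubes. Everything
follows by dominated convergence, from two facts.

* Domination (`exists_integrable_bound`). In `Φ^* (g dξ)` the coefficient of `dτ_1 ∧ … ∧ dτ_ℓ` is
  `g(τ Ξ)` times a form that grows polynomially in `τ`. Over a compact set of frames `‖τ Ξ‖` is
  bounded below by a multiple of `‖τ‖`, so that a single integrable function of `τ` dominates the
  integrands of all `g` with `|g| ≤ |f|`. For `z ∈ T(Ξ)` the exponential has modulus at most one on
  the fibre, whence absolute convergence and the limit as `z → x`; that `x` is a limit point of the
  tube is the existence of a functional positive on a closed pointed cone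
  (`IsPointedConvexCone.exists_dotProduct_pos`).

* Measurability in `Ξ` (`mem_fiber_iff`). A slice is convex, and it is a component of `L ∩ V`, so
  `τ Ξ` belongs to `v(Ξ)` exactly if the segment from `τ Ξ` to `(1, …, 1) Ξ` lies in `V`. This
  condition is open in `(Ξ, τ)`; hence the fibres over a simplex form a measurable set, and Fubini's
  theorem makes the fibre integral a measurable function on the simplex.

Multiplying the form by compactly supported cutoff functions that tend to one on `V` then gives
the identity in the limit (`chainIntegral_laplaceForm_realPoint`), and since `f` vanishes outside
`closure V` and `∂V` is a null set, the integral over `V` is the Fourier integral of `f`.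
-/

noncomputable section

namespace CohLaplace

/-! ### The map `(τ, Ξ) ↦ τ Ξ` and the coefficient form -/

lemma isBoundedBilinearMap_frameMap {ℓ n : ℕ} :
    IsBoundedBilinearMap ℝ (frameMap : (Fin ℓ → ℝ) × (Fin ℓ → Fin n → ℝ) → Fin n → ℝ) where
  add_left x y z := by simp [frameMap, add_smul, Finset.sum_add_distrib]
  smul_left c x y := by simp [frameMap, mul_smul, Finset.smul_sum]
  add_right x y z := by simp [frameMap, Finset.sum_add_distrib]
  smul_right c x y := by
    simp only [frameMap, Finset.smul_sum, Pi.smul_apply]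
    exact Finset.sum_congr rfl fun j _ => smul_comm _ _ _
  bound := by
    refine ⟨ℓ + 1, by positivity, fun τ Ξ => ?_⟩
    calc ‖frameMap (τ, Ξ)‖ ≤ ∑ j, ‖τ j • Ξ j‖ := norm_sum_le _ _
      _ ≤ ∑ _j : Fin ℓ, ‖τ‖ * ‖Ξ‖ := Finset.sum_le_sum fun j _ => by
          rw [norm_smul]
          gcongr
          · exact norm_le_pi_norm τ j
          · exact norm_le_pi_norm Ξ j
      _ = ℓ * (‖τ‖ * ‖Ξ‖) := by simp
      _ ≤ (ℓ + 1) * ‖τ‖ * ‖Ξ‖ := by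
          rw [mul_assoc]
          gcongr
          linarith

lemma continuous_frameMap {ℓ n : ℕ} :
    Continuous (frameMap : (Fin ℓ → ℝ) × (Fin ℓ → Fin n → ℝ) → Fin n → ℝ) :=
  isBoundedBilinearMap_frameMap.continuous

lemma frameMap_smul {ℓ n : ℕ} (c : ℝ) (τ : Fin ℓ → ℝ) (Ξ : Fin ℓ → Fin n → ℝ) :
    frameMap (c • τ, Ξ) = c • frameMap (τ, Ξ) :=
  isBoundedBilinearMap_frameMap.smul_left c τ Ξ

lemma frameMap_add {ℓ n : ℕ} (τ τ' : Fin ℓ → ℝ) (Ξ : Fin ℓ → Fin n → ℝ) :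
    frameMap (τ + τ', Ξ) = frameMap (τ, Ξ) + frameMap (τ', Ξ) :=
  isBoundedBilinearMap_frameMap.add_left τ τ' Ξ

lemma frameMap_single {ℓ n : ℕ} (j : Fin ℓ) (Ξ : Fin ℓ → Fin n → ℝ) :
    frameMap (Pi.single j 1, Ξ) = Ξ j := by
  simp [frameMap, Pi.single_apply]

section Contract

variable {E : Type*} [NormedAddCommGroup E] [NormedSpace ℝ E] {q : ℕ}

lemma contract_smul (k : ℕ) (c : ℂ) (α : E [⋀^Fin (q + k)]→L[ℝ] ℂ) (e : Fin k → E) :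
    contract k (c • α) e = c • contract k α e := by
  induction k with
  | zero => rfl
  | succ k ih =>
    exact ih (ContinuousAlternatingMap.curryLeft (n := q + k) α (e 0)) (Fin.tail e)

lemma norm_contract_le (k : ℕ) (α : E [⋀^Fin (q + k)]→L[ℝ] ℂ) (e : Fin k → E)
    (he : ∀ i, ‖e i‖ ≤ 1) : ‖contract k α e‖ ≤ ‖α‖ := by
  induction k with
  | zero => exact le_rfl
  | succ k ih =>
    refine (ih _ _ fun i => he _).trans ?_
    have := (ContinuousAlternatingMap.curryLeft (n := q + k) α).le_opNorm (e 0)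
    rw [ContinuousAlternatingMap.norm_curryLeft] at this
    exact this.trans (mul_le_of_le_one_right (norm_nonneg _) (he 0))

lemma continuous_contract (k : ℕ) (e : Fin k → E) :
    Continuous fun α : E [⋀^Fin (q + k)]→L[ℝ] ℂ => contract k α e := by
  induction k with
  | zero => exact continuous_id
  | succ k ih =>
    refine (ih (Fin.tail e)).comp ?_
    exact (ContinuousLinearMap.apply ℝ _ (e 0)).continuous.comp
      (ContinuousAlternatingMap.curryLeftLI (n := q + k) (𝕜 := ℝ) (E := E) (F := ℂ)).continuous

end Contract

variable {q ℓ : ℕ}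

/-- The coefficient of `dτ_1 ∧ … ∧ dτ_ℓ` in the pullback of the volume form. -/
def coeffForm (Ξ : Fin ℓ → Fin (q + ℓ) → ℝ) (τ : Fin ℓ → ℝ) :
    (Fin ℓ → Fin (q + ℓ) → ℝ) [⋀^Fin q]→L[ℝ] ℂ :=
  fiberIntegrand (fun _ => volForm (q + ℓ)) Ξ τ

lemma fiberIntegrand_smul_volForm (g : (Fin (q + ℓ) → ℝ) → ℂ) (Ξ : Fin ℓ → Fin (q + ℓ) → ℝ)
    (τ : Fin ℓ → ℝ) :
    fiberIntegrand (fun ξ => g ξ • volForm (q + ℓ)) Ξ τ =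
      g (frameMap (τ, Ξ)) • coeffForm Ξ τ := by
  have h : pullbackForm (fun ξ => g ξ • volForm (q + ℓ)) (τ, Ξ) =
      g (frameMap (τ, Ξ)) • pullbackForm (fun _ => volForm (q + ℓ)) (τ, Ξ) := rfl
  rw [coeffForm, fiberIntegrand, h, contract_smul]
  rfl

lemma continuous_coeffForm :
    Continuous fun p : (Fin ℓ → Fin (q + ℓ) → ℝ) × (Fin ℓ → ℝ) => coeffForm p.1 p.2 := by
  have hd : Continuous fun p : (Fin ℓ → Fin (q + ℓ) → ℝ) × (Fin ℓ → ℝ) =>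
      fderiv ℝ (frameMap : (Fin ℓ → ℝ) × (Fin ℓ → Fin (q + ℓ) → ℝ) → _) (p.2, p.1) :=
    ((isBoundedBilinearMap_frameMap.contDiff (n := 1)).continuous_fderiv one_ne_zero).comp
      (continuous_snd.prodMk continuous_fst)
  refine (ContinuousAlternatingMap.compContinuousLinearMapCLM (𝕜 := ℝ) (F := ℂ) (ι := Fin q)
    (ContinuousLinearMap.inr ℝ (Fin ℓ → ℝ) (Fin ℓ → Fin (q + ℓ) → ℝ))).continuous.comp ?_
  refine (continuous_contract ℓ _).comp ?_
  exact (ContinuousLinearMap.apply ℝ _ (volForm (q + ℓ))).continuous.comp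
    (ContinuousAlternatingMap.continuous_compContinuousLinearMapCLM.comp hd)

lemma exists_norm_coeffForm_le (q ℓ : ℕ) :
    ∃ C : ℝ, 0 ≤ C ∧ ∀ (Ξ : Fin ℓ → Fin (q + ℓ) → ℝ) (τ : Fin ℓ → ℝ),
      ‖coeffForm Ξ τ‖ ≤ C * (‖τ‖ + ‖Ξ‖) ^ (q + ℓ) := by
  have hb := isBoundedBilinearMap_frameMap (ℓ := ℓ) (n := q + ℓ)
  obtain ⟨D, hD, hDle⟩ := hb.isBoundedLinearMap_deriv.bound
  set i := ContinuousLinearMap.inr ℝ (Fin ℓ → ℝ) (Fin ℓ → Fin (q + ℓ) → ℝ)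
  refine ⟨‖volForm (q + ℓ)‖ * D ^ (q + ℓ) * ‖i‖ ^ q, by positivity, fun Ξ τ => ?_⟩
  have h1 : ‖fderiv ℝ (frameMap : (Fin ℓ → ℝ) × (Fin ℓ → Fin (q + ℓ) → ℝ) → _) (τ, Ξ)‖
      ≤ D * (‖τ‖ + ‖Ξ‖) := by
    rw [hb.fderiv]
    refine (hDle _).trans ?_
    gcongr
    rw [Prod.norm_mk]
    exact max_le_add_of_nonneg (norm_nonneg _) (norm_nonneg _)
  calc ‖coeffForm Ξ τ‖
      ≤ ‖contract ℓ (pullbackForm (fun _ => volForm (q + ℓ)) (τ, Ξ))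
          fun j => (Pi.single j 1, 0)‖ * ‖i‖ ^ q := by
        rw [coeffForm, fiberIntegrand]
        refine (ContinuousAlternatingMap.norm_compContinuousLinearMap_le _ _).trans ?_
        rw [Fintype.card_fin]
    _ ≤ ‖pullbackForm (fun _ => volForm (q + ℓ)) (τ, Ξ)‖ * ‖i‖ ^ q := by
        gcongr
        refine norm_contract_le _ _ _ fun j => ?_
        rw [Prod.norm_mk, norm_zero, Pi.norm_single, norm_one]
        simp
    _ ≤ ‖volForm (q + ℓ)‖ * (D * (‖τ‖ + ‖Ξ‖)) ^ (q + ℓ) * ‖i‖ ^ q := by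
        gcongr
        refine (ContinuousAlternatingMap.norm_compContinuousLinearMap_le _ _).trans ?_
        rw [Fintype.card_fin]
        gcongr
    _ = _ := by rw [mul_pow]; ring

/-! ### Slices and fibres -/

lemma frameMap_one_mem_hedron {ℓ n : ℕ} (Ξ : Fin ℓ → Fin n → ℝ) :
    frameMap (1, Ξ) ∈ hedron Ξ :=
  ⟨1, fun _ => one_pos, rfl⟩

lemma frameMap_mem_of_hedron_subset {ℓ n : ℕ} {Ξ : Fin ℓ → Fin n → ℝ}
    {L : Submodule ℝ (Fin n → ℝ)} (h : hedron Ξ ⊆ L) (τ : Fin ℓ → ℝ) : frameMap (τ, Ξ) ∈ L := by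
  refine Submodule.sum_mem _ fun j _ => Submodule.smul_mem _ _ ?_
  have h1 : frameMap (1 + Pi.single j 1, Ξ) ∈ L :=
    h ⟨_, fun k => by
      have : 0 ≤ (Pi.single j 1 : Fin ℓ → ℝ) k := (Pi.single_nonneg (i := j).2 zero_le_one : (0 : Fin ℓ → ℝ) ≤ _) k
      simp only [Pi.add_apply, Pi.one_apply]
      linarith, rfl⟩
  rw [frameMap_add, frameMap_single] at h1
  exact (Submodule.add_mem_iff_right _ (h (frameMap_one_mem_hedron Ξ))).1 h1

lemma IsPointedComponent.subset {n : ℕ} {V v : Set (Fin n → ℝ)} {L : Submodule ℝ (Fin n → ℝ)}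
    (h : IsPointedComponent V L v) : v ⊆ (L : Set (Fin n → ℝ)) ∩ V := by
  obtain ⟨⟨ξ, -, rfl⟩, -⟩ := h
  exact connectedComponentIn_subset _ _

lemma IsPointedComponent.segment_subset_iff {n : ℕ} {V v : Set (Fin n → ℝ)}
    {L : Submodule ℝ (Fin n → ℝ)} (h : IsPointedComponent V L v) {ζ ξ : Fin n → ℝ}
    (hζ : ζ ∈ v) (hξ : ξ ∈ L) : ξ ∈ v ↔ segment ℝ ξ ζ ⊆ V := by
  refine ⟨fun hv => (h.2.2.1.segment_subset hv hζ).trans (h.subset.trans inter_subset_right),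
    fun hs => ?_⟩
  have hζL := (h.subset hζ).1
  obtain ⟨⟨ξ₀, -, rfl⟩, -⟩ := h
  rw [connectedComponentIn_eq hζ]
  exact (convex_segment ξ ζ).isPreconnected.subset_connectedComponentIn
    (right_mem_segment ℝ ξ ζ) (subset_inter (L.convex.segment_subset hξ hζL) hs)
    (left_mem_segment ℝ ξ ζ)

section Fiber

variable {V : Set (Fin (q + ℓ) → ℝ)} {A : Set (Set (Fin (q + ℓ) → ℝ))}
  {Ξ : Fin ℓ → Fin (q + ℓ) → ℝ}

/-- The set of all `(Ξ, τ)` such that the segment from `τ Ξ` to `(1, …, 1) Ξ` lies in `V`. -/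
def visibleSet (V : Set (Fin (q + ℓ) → ℝ)) :
    Set ((Fin ℓ → Fin (q + ℓ) → ℝ) × (Fin ℓ → ℝ)) :=
  {p | segment ℝ (frameMap (p.2, p.1)) (frameMap (1, p.1)) ⊆ V}

lemma isOpen_visibleSet (hV : IsOpen V) : IsOpen (visibleSet (ℓ := ℓ) V) := by
  have heq : visibleSet (ℓ := ℓ) V = {p | ∀ s ∈ Icc (0 : ℝ) 1,
      AffineMap.lineMap (frameMap (p.2, p.1)) (frameMap (1, p.1)) s ∈ V} := by
    ext p
    rw [visibleSet, mem_ofPred_eq, segment_eq_image_lineMap, image_subset_iff]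
    rfl
  rw [heq, isOpen_iff_mem_nhds]
  intro p hp
  have hc : Continuous fun r : ((Fin ℓ → Fin (q + ℓ) → ℝ) × (Fin ℓ → ℝ)) × ℝ =>
      (AffineMap.lineMap (frameMap (r.1.2, r.1.1)) (frameMap (1, r.1.1)) r.2 :
        Fin (q + ℓ) → ℝ) := by
    have h1 := continuous_frameMap (ℓ := ℓ) (n := q + ℓ)
    simp only [AffineMap.lineMap_apply_module]
    fun_prop
  exact isCompact_Icc.eventually_forall_of_forall_eventually fun s hs =>
    (hV.preimage hc).mem_nhds (hp s hs)

/-- Whether `τ` belongs to the fibre over `Ξ` can be read off from `V` alone: the slice through the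
positive hull of `Ξ` is star-shaped about `(1, …, 1) Ξ`. Hence the set of pairs
`(Ξ, τ)` with `τ` in the fibre over `Ξ` is relatively open. -/
lemma mem_fiber_iff (hA : ∀ v ∈ A, IsSlice V v) (hΞ : Ξ ∈ paramSpace A ℓ) {τ : Fin ℓ → ℝ} :
    τ ∈ fiber A Ξ ↔ (Ξ, τ) ∈ visibleSet V := by
  have key : ∀ v ∈ A, hedron Ξ ⊆ v →
      (frameMap (τ, Ξ) ∈ v ↔ (Ξ, τ) ∈ visibleSet V) := by
    intro v hv hΞv
    obtain ⟨L, hL, -⟩ := hA v hv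
    exact hL.segment_subset_iff (hΞv (frameMap_one_mem_hedron Ξ)) (frameMap_mem_of_hedron_subset
      (hΞv.trans (hL.subset.trans inter_subset_left)) τ)
  obtain ⟨-, v, hv, hΞv⟩ := hΞ
  constructor
  · rintro ⟨w, ⟨hw, hΞw⟩, hτ⟩
    exact (key w hw hΞw).1 hτ
  · exact fun h => ⟨v, ⟨hv, hΞv⟩, (key v hv hΞv).2 h⟩

lemma frameMap_mem_of_mem_fiber (hA : ∀ v ∈ A, IsSlice V v) (hΞ : Ξ ∈ paramSpace A ℓ)
    {τ : Fin ℓ → ℝ} (hτ : τ ∈ fiber A Ξ) : frameMap (τ, Ξ) ∈ V :=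
  (mem_fiber_iff hA hΞ).1 hτ (left_mem_segment ℝ _ _)

lemma measurableSet_fiber (hV : IsOpen V) (hA : ∀ v ∈ A, IsSlice V v)
    (hΞ : Ξ ∈ paramSpace A ℓ) : MeasurableSet (fiber A Ξ) := by
  have : fiber A Ξ = Prod.mk Ξ ⁻¹' visibleSet V := by
    ext τ
    exact mem_fiber_iff hA hΞ
  rw [this]
  exact ((isOpen_visibleSet hV).preimage (by fun_prop)).measurableSet

/-- A linearly independent family of `ℓ` vectors spans the `ℓ`-dimensional space of each slice
that contains its positive hull, so that this slice is unique. -/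
lemma sliceOf_eq (hq : nonconvexityIndex V = q) (hA : ∀ v ∈ A, IsSlice V v)
    (hΞ : LinearIndependent ℝ Ξ) {v : Set (Fin (q + ℓ) → ℝ)} (hv : v ∈ A)
    (hΞv : hedron Ξ ⊆ v) : sliceOf A Ξ = v := by
  have span_eq : ∀ (w : Set (Fin (q + ℓ) → ℝ)) (L : Submodule ℝ (Fin (q + ℓ) → ℝ)),
      hedron Ξ ⊆ w → IsPointedComponent V L w →
      Module.finrank ℝ ((Fin (q + ℓ) → ℝ) ⧸ L) = nonconvexityIndex V →
      Submodule.span ℝ (range Ξ) = L := by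
    intro w L hw hL hfin
    refine Submodule.eq_of_le_of_finrank_eq (Submodule.span_le.2 ?_) ?_
    · rintro _ ⟨j, rfl⟩
      rw [← frameMap_single j Ξ]
      exact frameMap_mem_of_hedron_subset (hw.trans (hL.subset.trans inter_subset_left)) _
    · have h1 := finrank_span_eq_card hΞ
      have h2 := L.finrank_quotient_add_finrank
      rw [hfin, hq, Module.finrank_fin_fun] at h2
      rw [h1, Fintype.card_fin]
      omega
  have h1 := frameMap_one_mem_hedron Ξ
  obtain ⟨L, hL, hLq⟩ := hA v hv
  refine Subset.antisymm (sUnion_subset ?_) (subset_sUnion_of_mem ⟨hv, hΞv⟩)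
  rintro w ⟨hw, hΞw⟩ ξ hξ
  obtain ⟨M, hM, hMq⟩ := hA w hw
  obtain rfl : L = M := (span_eq v L hΞv hL hLq).symm.trans (span_eq w M hΞw hM hMq)
  have hξL := (hM.subset hξ).1
  exact (hL.segment_subset_iff (hΞv h1) hξL).2 ((hM.segment_subset_iff (hΞw h1) hξL).1 hξ)

lemma isPointedConvexCone_sliceOf (hq : nonconvexityIndex V = q) (hA : ∀ v ∈ A, IsSlice V v)
    (hΞ : Ξ ∈ paramSpace A ℓ) :
    IsPointedConvexCone (sliceOf A Ξ) ∧ (sliceOf A Ξ).Nonempty := by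
  obtain ⟨hli, v, hv, hΞv⟩ := hΞ
  rw [sliceOf_eq hq hA hli hv hΞv]
  obtain ⟨L, hL, -⟩ := hA v hv
  exact ⟨hL.2, _, hΞv (frameMap_one_mem_hedron Ξ)⟩

end Fiber

/-! ### The dual wedge and the tube -/

/-- The dual cone of a pointed convex cone has an element that is positive on all nonzero vectors
of the closure. Each vector has a nonnegative functional that is positive near it, by
Hahn–Banach applied to its negative; finitely many of these suffice on the unit sphere. -/
lemma IsPointedConvexCone.exists_dotProduct_pos {n : ℕ} {v : Set (Fin n → ℝ)}
    (hv : IsPointedConvexCone v) (hne : v.Nonempty) :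
    ∃ y : Fin n → ℝ, ∀ ξ ∈ closure v, ξ ≠ 0 → 0 < ξ ⬝ᵥ y := by
  obtain ⟨hcone, hconv, hpt⟩ := hv
  have hcl : ∀ t : ℝ, 0 < t → ∀ ξ ∈ closure v, t • ξ ∈ closure v := fun t ht ξ hξ =>
    map_mem_closure (continuous_const_smul t) hξ (fun ζ hζ => hcone t ht ζ hζ)
  have h0 : (0 : Fin n → ℝ) ∈ closure v := by
    obtain ⟨ξ, hξ⟩ := hne
    have hlim : Tendsto (fun t : ℝ => t • ξ) (𝓝[>] 0) (𝓝 0) := by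
      have : Tendsto (fun t : ℝ => t • ξ) (𝓝 0) (𝓝 ((0 : ℝ) • ξ)) :=
        (continuous_id.smul continuous_const).tendsto 0
      rw [zero_smul] at this
      exact this.mono_left nhdsWithin_le_nhds
    exact mem_closure_of_tendsto hlim (eventually_mem_nhdsWithin.mono fun t ht => hcone t ht ξ hξ)
  have hK : IsCompact (closure v ∩ Metric.sphere 0 1) :=
    (isCompact_sphere 0 1).inter_left isClosed_closure
  have main : ∃ φ : StrongDual ℝ (Fin n → ℝ), (∀ ξ ∈ closure v, 0 ≤ φ ξ) ∧
      ∀ ξ ∈ closure v ∩ Metric.sphere 0 1, 0 < φ ξ := by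
    refine hK.induction_on
      (p := fun s => ∃ φ : StrongDual ℝ (Fin n → ℝ), (∀ ξ ∈ closure v, 0 ≤ φ ξ) ∧
        ∀ ξ ∈ s ∩ (closure v), 0 < φ ξ) ⟨0, by simp, by simp⟩ ?_ ?_ ?_ |>.imp ?_
    · rintro s t hst ⟨φ, h1, h2⟩
      exact ⟨φ, h1, fun ξ hξ => h2 ξ ⟨hst hξ.1, hξ.2⟩⟩
    · rintro s t ⟨φ, h1, h2⟩ ⟨ψ, h3, h4⟩
      refine ⟨φ + ψ, fun ξ hξ => add_nonneg (h1 ξ hξ) (h3 ξ hξ), ?_⟩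
      rintro ξ ⟨hξ | hξ, hv⟩
      · exact add_pos_of_pos_of_nonneg (h2 ξ ⟨hξ, hv⟩) (h3 ξ hv)
      · exact add_pos_of_nonneg_of_pos (h1 ξ hv) (h4 ξ ⟨hξ, hv⟩)
    · rintro ξ ⟨hξ, hξ1⟩
      have hneg : -ξ ∉ closure v := fun h => by
        rw [hpt ξ hξ h] at hξ1
        simp at hξ1
      obtain ⟨φ, u, hu, hφ⟩ :=
        geometric_hahn_banach_point_closed hconv.closure isClosed_closure hneg
      have hu0 : u < 0 := by simpa using hφ 0 h0
      have hnn : ∀ ζ ∈ closure v, 0 ≤ φ ζ := by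
        intro ζ hζ
        by_contra! hlt
        -- scaling `ζ` by `u / φ ζ` would bring `φ` down to its strict lower bound `u`
        have := hφ _ (hcl (u / φ ζ) (div_pos_of_neg_of_neg hu0 hlt) ζ hζ)
        rw [map_smul, smul_eq_mul, div_mul_cancel₀ _ hlt.ne] at this
        exact lt_irrefl _ this
      have hpos : 0 < φ ξ := by
        rw [map_neg] at hu
        linarith
      exact ⟨{ζ | 0 < φ ζ}, mem_nhdsWithin_of_mem_nhds
        ((isOpen_lt continuous_const φ.continuous).mem_nhds hpos), φ, hnn, fun ζ hζ => hζ.1⟩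
    · rintro φ ⟨h1, h2⟩
      exact ⟨h1, fun ξ hξ => h2 ξ ⟨hξ, hξ.1⟩⟩
  obtain ⟨φ, -, hφ⟩ := main
  refine ⟨fun k => φ (Pi.single k 1), fun ξ hξ hξ0 => ?_⟩
  have hdot : ξ ⬝ᵥ (fun k => φ (Pi.single k 1)) = φ ξ := by
    conv_rhs => rw [pi_eq_sum_univ' ξ]
    simp [dotProduct]
  have hpos : 0 < ‖ξ‖ := norm_pos_iff.2 hξ0
  have := hφ (‖ξ‖⁻¹ • ξ) ⟨hcl _ (inv_pos.2 hpos) ξ hξ, by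
    simp [norm_smul, inv_mul_cancel₀ hpos.ne']⟩
  rw [map_smul, smul_eq_mul] at this
  rw [hdot]
  exact pos_of_mul_pos_right this (inv_pos.2 hpos).le

section Tube

variable {V : Set (Fin (q + ℓ) → ℝ)} {A : Set (Set (Fin (q + ℓ) → ℝ))}
  {Ξ : Fin ℓ → Fin (q + ℓ) → ℝ}

lemma realPoint_mem_closure_tube (hq : nonconvexityIndex V = q) (hA : ∀ v ∈ A, IsSlice V v)
    (hΞ : Ξ ∈ paramSpace A ℓ) (x : Fin (q + ℓ) → ℝ) : realPoint x ∈ closure (tube A Ξ) := by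
  obtain ⟨hcone, hne⟩ := isPointedConvexCone_sliceOf hq hA hΞ
  obtain ⟨y, hy⟩ := hcone.exists_dotProduct_pos hne
  let p : ℝ → Fin (q + ℓ) → ℂ := fun t k => x k + (t * y k : ℝ) * Complex.I
  have hlim : Tendsto p (𝓝[>] 0) (𝓝 (realPoint x)) := by
    have hp : Continuous p := by fun_prop
    have h0 : p 0 = realPoint x := by
      ext k
      simp [p, realPoint]
    rw [← h0]
    exact hp.continuousAt.mono_left nhdsWithin_le_nhds
  refine mem_closure_of_tendsto hlim (eventually_mem_nhdsWithin.mono fun t ht ξ hξ hξ0 => ?_)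
  have him : (fun k => (p t k).im) = t • y := by
    ext k
    simp [p]
  rw [him, dotProduct_smul]
  exact smul_pos ht (hy ξ hξ hξ0)

lemma norm_exp_le_one {z : Fin (q + ℓ) → ℂ} (hz : z ∈ tube A Ξ) {τ : Fin ℓ → ℝ}
    (hτ : τ ∈ fiber A Ξ) :
    ‖Complex.exp (Complex.I * ∑ k, ((frameMap (τ, Ξ) k : ℝ) : ℂ) * z k)‖ ≤ 1 := by
  have him : (∑ k, ((frameMap (τ, Ξ) k : ℝ) : ℂ) * z k).im =
      frameMap (τ, Ξ) ⬝ᵥ fun k => (z k).im := by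
    simp [dotProduct]
  rw [Complex.norm_exp, Real.exp_le_one_iff, Complex.I_mul_re, him, neg_nonpos]
  rcases eq_or_ne (frameMap (τ, Ξ)) 0 with h | h
  · simp [h]
  · exact (hz _ (subset_closure hτ) h).le

end Tube

/-! ### Uniform bounds over compact sets of frames -/

lemma exists_pos_mul_norm_le_norm_frameMap {ℓ n : ℕ} {K : Set (Fin ℓ → Fin n → ℝ)}
    (hK : IsCompact K) (hli : ∀ Ξ ∈ K, LinearIndependent ℝ Ξ) :
    ∃ δ : ℝ, 0 < δ ∧ ∀ Ξ ∈ K, ∀ τ : Fin ℓ → ℝ, δ * ‖τ‖ ≤ ‖frameMap (τ, Ξ)‖ := by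
  have hpos : ∀ p ∈ Metric.sphere (0 : Fin ℓ → ℝ) 1 ×ˢ K, 0 < ‖frameMap p‖ := by
    rintro ⟨τ, Ξ⟩ ⟨hτ, hΞ⟩
    refine norm_pos_iff.2 fun h => ?_
    have : τ = 0 := funext (Fintype.linearIndependent_iff.1 (hli Ξ hΞ) τ h)
    simp [this] at hτ
  obtain ⟨δ, hδ, hle⟩ := ((isCompact_sphere 0 1).prod hK).exists_forall_le'
    continuous_frameMap.norm.continuousOn hpos
  refine ⟨δ, hδ, fun Ξ hΞ τ => ?_⟩
  rcases eq_or_ne τ 0 with rfl | hτ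
  · simp
  have hτ' := norm_pos_iff.2 hτ
  have := hle (‖τ‖⁻¹ • τ, Ξ) ⟨by simp [norm_smul, inv_mul_cancel₀ hτ'.ne'], hΞ⟩
  rwa [frameMap_smul, norm_smul, norm_inv, norm_norm, ← div_eq_inv_mul, le_div_iff₀ hτ'] at this

lemma exists_one_add_norm_pow_mul_le {n : ℕ} (f : 𝓢(Fin n → ℝ, ℂ)) (m : ℕ) :
    ∃ C : ℝ, 0 ≤ C ∧ ∀ ξ, (1 + ‖ξ‖) ^ m * ‖f ξ‖ ≤ C := by
  have h : ∀ ξ, (1 + ‖ξ‖) ^ m * ‖f ξ‖ ≤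
      2 ^ m * (Finset.Iic (m, 0)).sup (fun m => SchwartzMap.seminorm ℝ m.1 m.2) f := fun ξ => by
    simpa using SchwartzMap.one_add_le_sup_seminorm_apply (𝕜 := ℝ) (m := (m, 0)) le_rfl le_rfl f ξ
  exact ⟨_, le_trans (by positivity) (h 0), h⟩

/-- Over a compact set of frames the vectors `τ Ξ` are at least proportional to `τ` in norm, so the
decay of `f` beats the polynomial growth of the coefficient form uniformly. -/
lemma exists_integrable_bound (f : 𝓢(Fin (q + ℓ) → ℝ, ℂ)) {K : Set (Fin ℓ → Fin (q + ℓ) → ℝ)}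
    (hK : IsCompact K) (hli : ∀ Ξ ∈ K, LinearIndependent ℝ Ξ) :
    ∃ B : (Fin ℓ → ℝ) → ℝ, Integrable B ∧
      ∀ Ξ ∈ K, ∀ τ, ‖f (frameMap (τ, Ξ))‖ * ‖coeffForm Ξ τ‖ ≤ B τ := by
  obtain ⟨δ, hδ, hδle⟩ := exists_pos_mul_norm_le_norm_frameMap hK hli
  obtain ⟨C, hC, hCle⟩ := exists_norm_coeffForm_le q ℓ
  obtain ⟨R, hR, hRle⟩ : ∃ R : ℝ, 0 ≤ R ∧ ∀ Ξ ∈ K, ‖Ξ‖ ≤ R := by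
    obtain ⟨R, hR⟩ := hK.isBounded.exists_norm_le
    exact ⟨max R 0, le_max_right _ _, fun Ξ hΞ => (hR Ξ hΞ).trans (le_max_left _ _)⟩
  obtain ⟨D, hD, hDle⟩ := exists_one_add_norm_pow_mul_le f (q + ℓ + (ℓ + 1))
  set ε := min δ 1
  have hε : 0 < ε := lt_min hδ one_pos
  refine ⟨fun τ => D / ε ^ (q + ℓ + (ℓ + 1)) * (C * (1 + R) ^ (q + ℓ)) *
    (1 + ‖τ‖) ^ (-((ℓ + 1 : ℕ) : ℝ)), ?_, fun Ξ hΞ τ => ?_⟩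
  · refine (integrable_one_add_norm ?_).const_mul _
    rw [Module.finrank_fin_fun]
    exact_mod_cast Nat.lt_succ_self ℓ
  have hτ : 0 < 1 + ‖τ‖ := by positivity
  have hlow : ε * (1 + ‖τ‖) ≤ 1 + ‖frameMap (τ, Ξ)‖ := by
    have h1 : ε * ‖τ‖ ≤ δ * ‖τ‖ := by gcongr; exact min_le_left _ _
    have h2 : ε ≤ 1 := min_le_right _ _
    have h3 := hδle Ξ hΞ τ
    linarith
  have hf : ‖f (frameMap (τ, Ξ))‖ ≤
      D / (ε ^ (q + ℓ + (ℓ + 1)) * (1 + ‖τ‖) ^ (q + ℓ + (ℓ + 1))) := by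
    rw [le_div_iff₀ (by positivity), ← mul_pow, mul_comm]
    refine le_trans ?_ (hDle (frameMap (τ, Ξ)))
    gcongr
  have hW : ‖coeffForm Ξ τ‖ ≤ C * ((1 + R) ^ (q + ℓ) * (1 + ‖τ‖) ^ (q + ℓ)) := by
    refine (hCle Ξ τ).trans ?_
    rw [← mul_pow]
    gcongr
    have h1 := hRle Ξ hΞ
    nlinarith [norm_nonneg τ, mul_nonneg hR (norm_nonneg τ)]
  refine (mul_le_mul hf hW (norm_nonneg _) (by positivity)).trans (le_of_eq ?_)
  beta_reduce
  rw [Real.rpow_neg hτ.le, Real.rpow_natCast]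
  field_simp
  ring

/-! ### Convergence of the fibre integrals and the boundary value -/

section Fiber

variable {V : Set (Fin (q + ℓ) → ℝ)} {A : Set (Set (Fin (q + ℓ) → ℝ))}
  {Ξ : Fin ℓ → Fin (q + ℓ) → ℝ} (f : 𝓢(Fin (q + ℓ) → ℝ, ℂ))

lemma continuous_fiberIntegrand {g : (Fin (q + ℓ) → ℝ) → ℂ} (hg : Continuous g) :
    Continuous fun p : (Fin ℓ → Fin (q + ℓ) → ℝ) × (Fin ℓ → ℝ) =>
      fiberIntegrand (fun ξ => g ξ • volForm (q + ℓ)) p.1 p.2 := by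
  simp only [fiberIntegrand_smul_volForm]
  exact (hg.comp (continuous_frameMap.comp (continuous_snd.prodMk continuous_fst))).smul
    continuous_coeffForm

lemma norm_fiberIntegrand_le {g : (Fin (q + ℓ) → ℝ) → ℂ} {τ : Fin ℓ → ℝ} {B : ℝ}
    (hg : ‖g (frameMap (τ, Ξ))‖ ≤ ‖f (frameMap (τ, Ξ))‖)
    (hB : ‖f (frameMap (τ, Ξ))‖ * ‖coeffForm Ξ τ‖ ≤ B) :
    ‖fiberIntegrand (fun ξ => g ξ • volForm (q + ℓ)) Ξ τ‖ ≤ B := by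
  rw [fiberIntegrand_smul_volForm, norm_smul]
  exact (mul_le_mul_of_nonneg_right hg (norm_nonneg _)).trans hB

lemma integrableOn_fiberIntegrand (hV : IsOpen V) (hA : ∀ v ∈ A, IsSlice V v)
    (hΞ : Ξ ∈ paramSpace A ℓ) {g : (Fin (q + ℓ) → ℝ) → ℂ} (hg : Continuous g)
    (hgf : ∀ τ ∈ fiber A Ξ, ‖g (frameMap (τ, Ξ))‖ ≤ ‖f (frameMap (τ, Ξ))‖) :
    IntegrableOn (fiberIntegrand (fun ξ => g ξ • volForm (q + ℓ)) Ξ) (fiber A Ξ) := by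
  obtain ⟨B, hB, hle⟩ := exists_integrable_bound f (isCompact_singleton (x := Ξ))
    (by rintro _ rfl; exact hΞ.1)
  refine hB.integrableOn.mono' (((continuous_fiberIntegrand hg).comp
    (continuous_const.prodMk continuous_id)).aestronglyMeasurable) ?_
  exact ae_restrict_of_forall_mem (measurableSet_fiber hV hA hΞ) fun τ hτ =>
    norm_fiberIntegrand_le f (hgf τ hτ) (hle Ξ rfl τ)

lemma tendsto_fiberIntegral {ι : Type*} {l : Filter ι} [l.IsCountablyGenerated] (hV : IsOpen V)
    (hA : ∀ v ∈ A, IsSlice V v) (hΞ : Ξ ∈ paramSpace A ℓ) {G : ι → (Fin (q + ℓ) → ℝ) → ℂ}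
    {g : (Fin (q + ℓ) → ℝ) → ℂ} (hG : ∀ i, Continuous (G i))
    (hGf : ∀ᶠ i in l, ∀ τ ∈ fiber A Ξ, ‖G i (frameMap (τ, Ξ))‖ ≤ ‖f (frameMap (τ, Ξ))‖)
    (hlim : ∀ τ ∈ fiber A Ξ,
      Tendsto (fun i => G i (frameMap (τ, Ξ))) l (𝓝 (g (frameMap (τ, Ξ))))) :
    Tendsto (fun i => fiberIntegral A (fun ξ => G i ξ • volForm (q + ℓ)) Ξ) l
      (𝓝 (fiberIntegral A (fun ξ => g ξ • volForm (q + ℓ)) Ξ)) := by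
  obtain ⟨B, hB, hle⟩ := exists_integrable_bound f (isCompact_singleton (x := Ξ))
    (by rintro _ rfl; exact hΞ.1)
  have hmeas := measurableSet_fiber hV hA hΞ
  refine tendsto_integral_filter_of_dominated_convergence B ?_ ?_ hB.integrableOn ?_
  · exact Eventually.of_forall fun i => ((continuous_fiberIntegrand (hG i)).comp
      (continuous_const.prodMk continuous_id)).aestronglyMeasurable
  · filter_upwards [hGf] with i hi
    exact ae_restrict_of_forall_mem hmeas fun τ hτ =>
      norm_fiberIntegrand_le f (hi τ hτ) (hle Ξ rfl τ)
  · refine ae_restrict_of_forall_mem hmeas fun τ hτ => ?_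
    simp only [fiberIntegrand_smul_volForm]
    exact (hlim τ hτ).smul_const _

/-- The coefficient `e^{i ξ z} f(ξ)` of the form `expForm f z`. -/
def expCoeff (f : (Fin (q + ℓ) → ℝ) → ℂ) (z : Fin (q + ℓ) → ℂ) (ξ : Fin (q + ℓ) → ℝ) : ℂ :=
  Complex.exp (Complex.I * ∑ k, (ξ k : ℂ) * z k) * f ξ

lemma continuous_expCoeff (z : Fin (q + ℓ) → ℂ) : Continuous (expCoeff f z) := by
  have := f.continuous
  unfold expCoeff
  fun_prop

lemma norm_expCoeff_le {z : Fin (q + ℓ) → ℂ} (hz : z ∈ tube A Ξ) {τ : Fin ℓ → ℝ}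
    (hτ : τ ∈ fiber A Ξ) : ‖expCoeff f z (frameMap (τ, Ξ))‖ ≤ ‖f (frameMap (τ, Ξ))‖ := by
  rw [expCoeff, norm_mul]
  exact mul_le_of_le_one_left (norm_nonneg _) (norm_exp_le_one hz hτ)

lemma expCoeff_realPoint (f : (Fin (q + ℓ) → ℝ) → ℂ) (x ξ : Fin (q + ℓ) → ℝ) :
    expCoeff f (realPoint x) ξ = Complex.exp (Complex.I * ((ξ ⬝ᵥ x : ℝ) : ℂ)) * f ξ := by
  simp [expCoeff, realPoint, dotProduct]

lemma norm_expCoeff_realPoint (f : (Fin (q + ℓ) → ℝ) → ℂ) (x ξ : Fin (q + ℓ) → ℝ) :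
    ‖expCoeff f (realPoint x) ξ‖ = ‖f ξ‖ := by
  rw [expCoeff_realPoint, norm_mul, Complex.norm_exp_I_mul_ofReal, one_mul]

lemma tendsto_laplaceForm (hV : IsOpen V) (hA : ∀ v ∈ A, IsSlice V v) (hΞ : Ξ ∈ paramSpace A ℓ)
    (x : Fin (q + ℓ) → ℝ) :
    Tendsto (fun z => laplaceForm A f z Ξ) (𝓝[tube A Ξ] (realPoint x))
      (𝓝 (laplaceForm A f (realPoint x) Ξ)) := by
  refine tendsto_fiberIntegral f hV hA hΞ (continuous_expCoeff f) ?_ fun τ _ => ?_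
  · filter_upwards [self_mem_nhdsWithin] with z hz τ hτ
    exact norm_expCoeff_le f hz hτ
  · have hc : Continuous fun z => expCoeff f z (frameMap (τ, Ξ)) := by
      unfold expCoeff
      fun_prop
    exact (hc.tendsto _).mono_left nhdsWithin_le_nhds

lemma boundaryValue_laplaceForm (hV : IsOpen V) (hq : nonconvexityIndex V = q)
    (hA : ∀ v ∈ A, IsSlice V v) (hΞ : Ξ ∈ paramSpace A ℓ) (x : Fin (q + ℓ) → ℝ) :
    boundaryValue A (laplaceForm A f) x Ξ = laplaceForm A f (realPoint x) Ξ := by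
  have : (𝓝[tube A Ξ] (realPoint x)).NeBot :=
    mem_closure_iff_nhdsWithin_neBot.1 (realPoint_mem_closure_tube hq hA hΞ x)
  exact (tendsto_laplaceForm f hV hA hΞ x).limUnder_eq

end Fiber

/-! ### Integration over a differentiable simplex -/

lemma continuous_baryCoords {p : ℕ} : Continuous (baryCoords (p := p)) := by
  unfold baryCoords
  refine continuous_pi fun i => ?_
  refine Fin.cases ?_ (fun j => ?_) i
  · simp only [Fin.cons_zero]
    fun_prop
  · simp only [Fin.cons_succ]
    fun_prop

lemma mem_cornerSimplex_iff {p : ℕ} {u : Fin p → ℝ} :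
    u ∈ cornerSimplex p ↔ (∀ i, 0 ≤ u i) ∧ ∑ i, u i ≤ 1 := by
  simp [cornerSimplex, baryCoords, stdSimplex, Fin.forall_fin_succ, Fin.sum_univ_succ, and_comm]

lemma isCompact_cornerSimplex (p : ℕ) : IsCompact (cornerSimplex p) := by
  refine (isCompact_Icc (a := (0 : Fin p → ℝ)) (b := 1)).of_isClosed_subset
    ((isClosed_stdSimplex ℝ _).preimage continuous_baryCoords) fun u hu => ?_
  rw [mem_cornerSimplex_iff] at hu
  exact ⟨hu.1, fun i => (Finset.single_le_sum (fun j _ => hu.1 j) (Finset.mem_univ i)).trans hu.2⟩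

lemma uniqueDiffOn_cornerSimplex (p : ℕ) : UniqueDiffOn ℝ (cornerSimplex p) := by
  refine uniqueDiffOn_convex ?_ ?_
  · intro u hu w hw a b ha hb hab
    rw [mem_cornerSimplex_iff] at hu hw ⊢
    refine ⟨fun i => add_nonneg (mul_nonneg ha (hu.1 i)) (mul_nonneg hb (hw.1 i)), ?_⟩
    simp only [Pi.add_apply, Pi.smul_apply, smul_eq_mul, Finset.sum_add_distrib, ← Finset.mul_sum]
    nlinarith [mul_le_mul_of_nonneg_left hu.2 ha, mul_le_mul_of_nonneg_left hw.2 hb]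
  · have hopen : IsOpen {u : Fin p → ℝ | (∀ i, 0 < u i) ∧ ∑ i, u i < 1} := by
      simp only [ofPred_and, ofPred_forall]
      exact (isOpen_iInter_of_finite fun i => isOpen_lt (by fun_prop) (by fun_prop)).inter
        (isOpen_lt (by fun_prop) (by fun_prop))
    refine ⟨fun _ => 1 / ((p : ℝ) + 1), interior_maximal ?_ hopen ⟨fun i => by positivity, ?_⟩⟩
    · rintro u ⟨h1, h2⟩
      exact mem_cornerSimplex_iff.2 ⟨fun i => (h1 i).le, h2.le⟩
    · simp only [Finset.sum_const, Finset.card_univ, Fintype.card_fin, nsmul_eq_mul]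
      rw [mul_one_div, div_lt_one (by positivity)]
      linarith

lemma inCoords_mem {E : Type*} [Zero E] {p : ℕ} {σ : stdSimplex ℝ (Fin (p + 1)) → E} {X : Set E}
    (hσ : ∀ t, σ t ∈ X) {u : Fin p → ℝ} (hu : u ∈ cornerSimplex p) : inCoords σ u ∈ X := by
  have h : inCoords σ u = σ ⟨baryCoords u, hu⟩ := dif_pos hu
  exact h ▸ hσ _

section Simplex

variable {V : Set (Fin (q + ℓ) → ℝ)} {A : Set (Set (Fin (q + ℓ) → ℝ))}
  (f : 𝓢(Fin (q + ℓ) → ℝ, ℂ)) {σ : stdSimplex ℝ (Fin (q + 1)) → Fin ℓ → Fin (q + ℓ) → ℝ}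

/-- The union of the fibres over a simplex is relatively open, so that Fubini's theorem yields the
measurability of the fibre integral. -/
lemma aestronglyMeasurable_fiberIntegral (hV : IsOpen V) (hA : ∀ v ∈ A, IsSlice V v)
    (hσ : ∀ t, σ t ∈ paramSpace A ℓ) (hc : ContinuousOn (inCoords σ) (cornerSimplex q))
    {g : (Fin (q + ℓ) → ℝ) → ℂ} (hg : Continuous g) :
    AEStronglyMeasurable
      (fun u => fiberIntegral A (fun ξ => g ξ • volForm (q + ℓ)) (inCoords σ u))
      (volume.restrict (cornerSimplex q)) := by
  have hS : MeasurableSet (cornerSimplex q) := (isCompact_cornerSimplex q).measurableSet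
  have hpair : ContinuousOn (fun p : (Fin q → ℝ) × (Fin ℓ → ℝ) => (inCoords σ p.1, p.2))
      (cornerSimplex q ×ˢ univ) :=
    (hc.comp continuousOn_fst fun p hp => hp.1).prodMk continuousOn_snd
  set D : Set ((Fin q → ℝ) × (Fin ℓ → ℝ)) :=
    (fun p => (inCoords σ p.1, p.2)) ⁻¹' visibleSet V ∩ cornerSimplex q ×ˢ univ
  have hD : MeasurableSet D := by
    obtain ⟨U, hU, hUeq⟩ := continuousOn_iff'.1 hpair _ (isOpen_visibleSet hV)
    change MeasurableSet (_ ∩ _)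
    rw [hUeq]
    exact hU.measurableSet.inter (hS.prod MeasurableSet.univ)
  have hF : AEStronglyMeasurable (D.indicator fun p : (Fin q → ℝ) × (Fin ℓ → ℝ) =>
      fiberIntegrand (fun ξ => g ξ • volForm (q + ℓ)) (inCoords σ p.1) p.2)
      (volume.prod volume) := by
    rw [aestronglyMeasurable_indicator_iff hD]
    exact (((continuous_fiberIntegrand hg).comp_continuousOn hpair).mono
      inter_subset_right).aestronglyMeasurable hD
  refine hF.integral_prod_right'.restrict.congr
    (ae_restrict_of_forall_mem hS fun u hu => ?_)
  have hΞ : inCoords σ u ∈ paramSpace A ℓ := inCoords_mem hσ hu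
  beta_reduce
  rw [fiberIntegral, ← integral_indicator (measurableSet_fiber hV hA hΞ)]
  congr 1
  ext1 τ
  have hiff : (u, τ) ∈ D ↔ τ ∈ fiber A (inCoords σ u) := by
    rw [mem_fiber_iff hA hΞ]
    exact and_iff_left ⟨hu, mem_univ _⟩
  by_cases h : τ ∈ fiber A (inCoords σ u)
  · rw [indicator_of_mem (hiff.2 h), indicator_of_mem h]
  · rw [indicator_of_notMem (mt hiff.1 h), indicator_of_notMem h]

lemma continuousOn_tangentVectors (hd : ContDiffOn ℝ 1 (inCoords σ) (cornerSimplex q)) :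
    ContinuousOn (fun u (i : Fin q) =>
      fderivWithin ℝ (inCoords σ) (cornerSimplex q) u (Pi.single i 1)) (cornerSimplex q) := by
  refine continuousOn_pi.2 fun i => ?_
  exact (hd.continuousOn_fderivWithin (uniqueDiffOn_cornerSimplex q) le_rfl).clm_apply
    continuousOn_const

lemma aestronglyMeasurable_simplexIntegrand (hV : IsOpen V) (hA : ∀ v ∈ A, IsSlice V v)
    (hσ : ∀ t, σ t ∈ paramSpace A ℓ) (hd : ContDiffOn ℝ 1 (inCoords σ) (cornerSimplex q))
    {g : (Fin (q + ℓ) → ℝ) → ℂ} (hg : Continuous g) :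
    AEStronglyMeasurable
      (simplexIntegrand (fiberIntegral A fun ξ => g ξ • volForm (q + ℓ)) σ)
      (volume.restrict (cornerSimplex q)) := by
  have heval : Continuous fun p : ((Fin ℓ → Fin (q + ℓ) → ℝ) [⋀^Fin q]→L[ℝ] ℂ) ×
      (Fin q → Fin ℓ → Fin (q + ℓ) → ℝ) => p.1 p.2 := by fun_prop
  exact heval.comp_aestronglyMeasurable
    ((aestronglyMeasurable_fiberIntegral hV hA hσ hd.continuousOn hg).prodMk
      ((continuousOn_tangentVectors hd).aestronglyMeasurable
        (isCompact_cornerSimplex q).measurableSet))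

lemma exists_norm_simplexIntegrand_le
    (hσ : ∀ t, σ t ∈ paramSpace A ℓ) (hd : ContDiffOn ℝ 1 (inCoords σ) (cornerSimplex q)) :
    ∃ C : ℝ, ∀ g : (Fin (q + ℓ) → ℝ) → ℂ, (∀ ξ, ‖g ξ‖ ≤ ‖f ξ‖) → ∀ u ∈ cornerSimplex q,
      ‖simplexIntegrand (fiberIntegral A fun ξ => g ξ • volForm (q + ℓ)) σ u‖ ≤ C := by
  have hS := isCompact_cornerSimplex q
  obtain ⟨B, hB, hle⟩ := exists_integrable_bound f (hS.image_of_continuousOn hd.continuousOn)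
    (by rintro _ ⟨u, hu, rfl⟩; exact (inCoords_mem hσ hu).1)
  obtain ⟨M, hM⟩ := hS.exists_bound_of_continuousOn (continuousOn_tangentVectors hd)
  refine ⟨(∫ τ, B τ) * M ^ q, fun g hg u hu => ?_⟩
  have hBu := hle _ (mem_image_of_mem _ hu)
  have hB0 : ∀ τ, 0 ≤ B τ := fun τ => le_trans (by positivity) (hBu τ)
  have hnorm : ‖fiberIntegral A (fun ξ => g ξ • volForm (q + ℓ)) (inCoords σ u)‖ ≤ ∫ τ, B τ :=
    (norm_integral_le_of_norm_le hB.integrableOn (Eventually.of_forall fun τ =>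
      norm_fiberIntegrand_le f (hg _) (hBu τ))).trans
      (setIntegral_le_integral hB (Eventually.of_forall hB0))
  refine (ContinuousAlternatingMap.le_opNorm_mul_pow_of_le _ (hM u hu)).trans ?_
  have : 0 ≤ M := (norm_nonneg _).trans (hM u hu)
  gcongr

lemma integrableOn_simplexIntegrand (hV : IsOpen V) (hA : ∀ v ∈ A, IsSlice V v)
    (hσ : ∀ t, σ t ∈ paramSpace A ℓ) (hd : ContDiffOn ℝ 1 (inCoords σ) (cornerSimplex q))
    {g : (Fin (q + ℓ) → ℝ) → ℂ} (hg : Continuous g) (hgf : ∀ ξ, ‖g ξ‖ ≤ ‖f ξ‖) :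
    IntegrableOn (simplexIntegrand (fiberIntegral A fun ξ => g ξ • volForm (q + ℓ)) σ)
      (cornerSimplex q) := by
  have hS := isCompact_cornerSimplex q
  obtain ⟨C, hC⟩ := exists_norm_simplexIntegrand_le f hσ hd
  exact IntegrableOn.of_bound hS.measure_lt_top
    (aestronglyMeasurable_simplexIntegrand hV hA hσ hd hg) C
    (ae_restrict_of_forall_mem hS.measurableSet (hC g hgf))

end Simplex

section Chain

variable {V : Set (Fin (q + ℓ) → ℝ)} {A : Set (Set (Fin (q + ℓ) → ℝ))}
  (f : 𝓢(Fin (q + ℓ) → ℝ, ℂ)) {γ : Chain (Fin ℓ → Fin (q + ℓ) → ℝ) q}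

lemma tendsto_chainIntegral_fiberIntegral (hV : IsOpen V) (hA : ∀ v ∈ A, IsSlice V v)
    (hγ : IsCycleIn (paramSpace A ℓ) γ) {G : ℕ → (Fin (q + ℓ) → ℝ) → ℂ}
    {g : (Fin (q + ℓ) → ℝ) → ℂ} (hG : ∀ k, Continuous (G k)) (hGf : ∀ k ξ, ‖G k ξ‖ ≤ ‖f ξ‖)
    (hlim : ∀ ξ ∈ V, Tendsto (fun k => G k ξ) atTop (𝓝 (g ξ))) :
    Tendsto (fun k => chainIntegral γ (fiberIntegral A fun ξ => G k ξ • volForm (q + ℓ))) atTop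
      (𝓝 (chainIntegral γ (fiberIntegral A fun ξ => g ξ • volForm (q + ℓ)))) := by
  refine tendsto_finsetSum _ fun σ hσ => Tendsto.const_mul _ ?_
  obtain ⟨hσA, hd⟩ := hγ.2 σ hσ
  obtain ⟨C, hC⟩ := exists_norm_simplexIntegrand_le f hσA hd
  have hS := isCompact_cornerSimplex q
  refine tendsto_integral_of_dominated_convergence (fun _ => C)
    (fun k => aestronglyMeasurable_simplexIntegrand hV hA hσA hd (hG k))
    (integrableOn_const hS.measure_lt_top.ne) (fun k =>
    ae_restrict_of_forall_mem hS.measurableSet (hC _ (hGf k)))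
    (ae_restrict_of_forall_mem hS.measurableSet fun u hu => ?_)
  have hΞ := inCoords_mem hσA hu
  have := tendsto_fiberIntegral f hV hA hΞ hG (Eventually.of_forall fun k τ _ => hGf k _)
    (fun τ hτ => hlim _ (frameMap_mem_of_mem_fiber hA hΞ hτ))
  exact ((continuous_eval_const _).tendsto _).comp this

end Chain

/-! ### Exhaustion of the cone by compactly supported forms -/

lemma exists_cutoff {n : ℕ} {V : Set (Fin n → ℝ)} (hV : IsOpen V) :
    ∃ χ : ℕ → (Fin n → ℝ) → ℝ, (∀ k, ContDiff ℝ ∞ (χ k)) ∧ (∀ k, HasCompactSupport (χ k)) ∧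
      (∀ k, tsupport (χ k) ⊆ V) ∧ (∀ k ξ, χ k ξ ∈ Icc (0 : ℝ) 1) ∧
      ∀ ξ ∈ V, Tendsto (fun k => χ k ξ) atTop (𝓝 1) := by
  obtain ⟨g, hgV, hg, hg01⟩ := hV.exists_contDiff_support_eq (n := ⊤)
  let b : ℕ → ContDiffBump (0 : Fin n → ℝ) := fun k =>
    { rIn := k + 1, rOut := k + 2, rIn_pos := by positivity, rIn_lt_rOut := by linarith }
  refine ⟨fun k ξ => Real.smoothTransition (k * g ξ - 1) * b k ξ, fun k => ?_, fun k => ?_,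
    fun k => ?_, fun k ξ => ?_, fun ξ hξ => ?_⟩
  · exact (Real.smoothTransition.contDiff.comp ((contDiff_const.mul hg).sub contDiff_const)).mul
      (b k).contDiff
  · exact (b k).hasCompactSupport.mul_left
  · -- the support lies in the closed set `k g ≥ 1`, on which `g` does not vanish
    have hcl : IsClosed {ξ | 1 ≤ k * g ξ} :=
      isClosed_le continuous_const (continuous_const.mul hg.continuous)
    refine (closure_minimal (fun ξ hξ => ?_) hcl).trans fun ξ hξ => ?_
    · by_contra hlt
      rw [mem_ofPred_eq, not_le] at hlt
      refine hξ ?_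
      simp only
      rw [Real.smoothTransition.zero_of_nonpos (by linarith), zero_mul]
    · rw [← hgV]
      intro h0
      rw [mem_ofPred_eq, h0, mul_zero] at hξ
      linarith
  · exact ⟨mul_nonneg (Real.smoothTransition.nonneg _) (b k).nonneg,
      mul_le_one₀ (Real.smoothTransition.le_one _) (b k).nonneg (b k).le_one⟩
  · have hpos : 0 < g ξ := by
      have h0 : g ξ ≠ 0 := by rwa [← Function.mem_support, hgV]
      exact lt_of_le_of_ne (hg01 (mem_range_self ξ)).1 h0.symm
    refine tendsto_const_nhds.congr' ?_
    filter_upwards [(tendsto_natCast_atTop_atTop (R := ℝ)).eventually_ge_atTop (2 / g ξ),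
      (tendsto_natCast_atTop_atTop (R := ℝ)).eventually_ge_atTop ‖ξ‖] with k hk1 hk2
    rw [div_le_iff₀ hpos] at hk1
    rw [Real.smoothTransition.one_of_one_le (by linarith), one_mul,
      (b k).one_of_mem_closedBall]
    rw [mem_closedBall_zero_iff]
    change ‖ξ‖ ≤ k + 1
    linarith

lemma volForm_single (n : ℕ) : volForm n (fun i => Pi.single i 1) = 1 := by
  have h : (fun i => Pi.single i 1 : Fin n → Fin n → ℝ) = (1 : Matrix (Fin n) (Fin n) ℝ) := by
    ext i j
    rw [Matrix.one_apply, Pi.single_apply]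
    simp only [eq_comm]
  change ((Matrix.det (fun i => Pi.single i 1 : Fin n → Fin n → ℝ) : ℝ) : ℂ) = 1
  rw [h, Matrix.det_one, Complex.ofReal_one]

lemma topIntegral_smul_volForm {n : ℕ} (V : Set (Fin n → ℝ)) (g : (Fin n → ℝ) → ℂ) :
    topIntegral V (fun ξ => g ξ • volForm n) = ∫ ξ in V, g ξ := by
  simp only [topIntegral, ContinuousAlternatingMap.smul_apply, volForm_single, smul_eq_mul,
    mul_one]

lemma contDiff_expCoeff (f : 𝓢(Fin (q + ℓ) → ℝ, ℂ)) (z : Fin (q + ℓ) → ℂ) :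
    ContDiff ℝ ∞ (expCoeff f z) := by
  have hsum : ContDiff ℝ ∞ fun ξ : Fin (q + ℓ) → ℝ => ∑ k, (ξ k : ℂ) * z k :=
    ContDiff.sum fun k _ =>
      (Complex.ofRealCLM.contDiff.comp (contDiff_apply ℝ ℝ k)).mul contDiff_const
  exact (contDiff_const.mul hsum).cexp.mul (f.smooth ⊤)

/-- The identity that defines the coefficient of a cycle extends from compactly supported forms in
`V` to the form `e^{i ξ x} f(ξ) dξ`, by dominated convergence on both sides. -/
lemma chainIntegral_laplaceForm_realPoint {V : Set (Fin (q + ℓ) → ℝ)} (hV : IsOpen V)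
    {A : Set (Set (Fin (q + ℓ) → ℝ))} (hA : ∀ v ∈ A, IsSlice V v)
    {γ : Chain (Fin ℓ → Fin (q + ℓ) → ℝ) q} (hγ : IsCycleIn (paramSpace A ℓ) γ) {c : ℤ}
    (hcγ : HasCoefficient V A γ c) (f : 𝓢(Fin (q + ℓ) → ℝ, ℂ)) (x : Fin (q + ℓ) → ℝ) :
    chainIntegral γ (laplaceForm A f (realPoint x)) =
      c * ∫ ξ in V, expCoeff f (realPoint x) ξ := by
  obtain ⟨χ, hχ, hχc, hχV, hχ01, hχlim⟩ := exists_cutoff hV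
  set e := expCoeff f (realPoint x)
  set G : ℕ → (Fin (q + ℓ) → ℝ) → ℂ := fun k ξ => (χ k ξ : ℂ) * e ξ
  have hG : ∀ k, ContDiff ℝ ∞ (G k) := fun k =>
    (Complex.ofRealCLM.contDiff.comp (hχ k)).mul (contDiff_expCoeff f _)
  have hGf : ∀ k ξ, ‖G k ξ‖ ≤ ‖f ξ‖ := fun k ξ => by
    rw [norm_mul, Complex.norm_real, Real.norm_of_nonneg (hχ01 k ξ).1,
      norm_expCoeff_realPoint]
    exact mul_le_of_le_one_left (norm_nonneg _) (hχ01 k ξ).2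
  have hlim : ∀ ξ ∈ V, Tendsto (fun k => G k ξ) atTop (𝓝 (e ξ)) := fun ξ hξ => by
    have := ((Complex.continuous_ofReal.tendsto _).comp (hχlim ξ hξ)).mul_const (e ξ)
    simpa using this
  have hsupp : ∀ k, Function.support (fun ξ => G k ξ • volForm (q + ℓ)) ⊆
      Function.support (χ k) := fun k ξ hξ h0 => hξ (by
      simp only [G, h0, Complex.ofReal_zero, zero_mul]
      exact zero_smul ℂ (volForm (q + ℓ)))
  have hid : ∀ k, chainIntegral γ (fiberIntegral A fun ξ => G k ξ • volForm (q + ℓ)) =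
      c * ∫ ξ in V, G k ξ := fun k => by
    rw [← topIntegral_smul_volForm]
    exact hcγ _ ((hG k).smul contDiff_const) ((hχc k).mono (hsupp k))
      ((closure_mono (hsupp k)).trans (hχV k))
  have h1 := tendsto_chainIntegral_fiberIntegral f hV hA hγ (fun k => (hG k).continuous) hGf hlim
  have h2 : Tendsto (fun k => ∫ ξ in V, G k ξ) atTop (𝓝 (∫ ξ in V, e ξ)) :=
    tendsto_integral_of_dominated_convergence (fun ξ => ‖f ξ‖)
      (fun k => (hG k).continuous.aestronglyMeasurable) f.integrable.norm.integrableOn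
      (fun k => Eventually.of_forall (hGf k))
      (ae_restrict_of_forall_mem hV.measurableSet hlim)
  simp only [hid] at h1
  exact tendsto_nhds_unique h1 (h2.const_mul _)

lemma setIntegral_expCoeff_eq_fourierInt {V : Set (Fin (q + ℓ) → ℝ)} (hV : IsOpen V)
    (hVbd : volume (frontier V) = 0) (f : 𝓢(Fin (q + ℓ) → ℝ, ℂ)) (hf : tsupport f ⊆ closure V)
    (x : Fin (q + ℓ) → ℝ) : ∫ ξ in V, expCoeff f (realPoint x) ξ = fourierInt f x := by
  have h0 : ∀ᵐ ξ : Fin (q + ℓ) → ℝ, ξ ∉ V → expCoeff f (realPoint x) ξ = 0 := by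
    filter_upwards [measure_eq_zero_iff_ae_notMem.1 hVbd] with ξ hξ hξV
    have : ξ ∉ tsupport f := fun h => hξ (hV.frontier_eq ▸ ⟨hf h, hξV⟩)
    rw [expCoeff, image_eq_zero_of_notMem_tsupport this, mul_zero]
  rw [setIntegral_eq_integral_of_ae_compl_eq_zero h0, fourierInt]
  simp only [expCoeff_realPoint]

lemma chainIntegral_congr {E : Type*} [NormedAddCommGroup E] [NormedSpace ℝ E] {X : Set E}
    {p : ℕ} {γ : Chain E p} (hγ : IsCycleIn X γ) {θ θ' : E → E [⋀^Fin p]→L[ℝ] ℂ}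
    (h : EqOn θ θ' X) : chainIntegral γ θ = chainIntegral γ θ' := by
  refine Finset.sum_congr rfl fun σ hσ => ?_
  have : ∫ u in cornerSimplex p, simplexIntegrand θ σ u =
      ∫ u in cornerSimplex p, simplexIntegrand θ' σ u :=
    setIntegral_congr_fun (isCompact_cornerSimplex p).measurableSet fun u hu => by
      simp only [simplexIntegrand, h (inCoords_mem (hγ.2 σ hσ).1 hu)]
  simp only [this]

end CohLaplace

end

theorem mainTheorem3 {q ℓ : ℕ}
    (V : Set (Fin (q + ℓ) → ℝ)) (hVopen : IsOpen V)
    (hVcone : ∀ t : ℝ, 0 < t → ∀ ξ ∈ V, t • ξ ∈ V)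
    (hVbd : volume (frontier V) = 0)
    (hq : CohLaplace.nonconvexityIndex V = q)
    (A : Set (Set (Fin (q + ℓ) → ℝ))) (hA : ∀ v ∈ A, CohLaplace.IsSlice V v)
    (γ : CohLaplace.Chain (Fin ℓ → Fin (q + ℓ) → ℝ) q)
    (hγ : CohLaplace.IsCycleIn (CohLaplace.paramSpace A ℓ) γ)
    (c : ℤ) (hc : c ≠ 0) (hcγ : CohLaplace.HasCoefficient V A γ c)
    (f : 𝓢(Fin (q + ℓ) → ℝ, ℂ)) (hf : tsupport f ⊆ closure V) :
    (∀ Ξ ∈ CohLaplace.paramSpace A ℓ, ∀ z ∈ CohLaplace.tube A Ξ,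
      IntegrableOn (CohLaplace.fiberIntegrand (CohLaplace.expForm f z) Ξ)
        (CohLaplace.fiber A Ξ)) ∧
    ∀ x : Fin (q + ℓ) → ℝ,
      (∀ Ξ ∈ CohLaplace.paramSpace A ℓ,
        CohLaplace.realPoint x ∈ closure (CohLaplace.tube A Ξ) ∧
        Tendsto (fun z => CohLaplace.laplaceForm A f z Ξ)
          (𝓝[CohLaplace.tube A Ξ] (CohLaplace.realPoint x))
          (𝓝 (CohLaplace.boundaryValue A (CohLaplace.laplaceForm A f) x Ξ))) ∧
      CohLaplace.ChainIntegrable γ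
        (CohLaplace.boundaryValue A (CohLaplace.laplaceForm A f) x) ∧
      CohLaplace.fourierInt f x =
        CohLaplace.boundaryMap A γ c (CohLaplace.laplaceForm A f) x := by
  have hbv : ∀ x, EqOn (CohLaplace.boundaryValue A (CohLaplace.laplaceForm A f) x)
      (CohLaplace.laplaceForm A f (CohLaplace.realPoint x)) (CohLaplace.paramSpace A ℓ) :=
    fun x Ξ hΞ => CohLaplace.boundaryValue_laplaceForm f hVopen hq hA hΞ x
  refine ⟨fun Ξ hΞ z hz => ?_, fun x => ⟨fun Ξ hΞ => ⟨?_, ?_⟩, fun σ hσ => ?_, ?_⟩⟩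
  · exact CohLaplace.integrableOn_fiberIntegrand f hVopen hA hΞ
      (CohLaplace.continuous_expCoeff f z) fun τ hτ => CohLaplace.norm_expCoeff_le f hz hτ
  · exact CohLaplace.realPoint_mem_closure_tube hq hA hΞ x
  · rw [hbv x hΞ]
    exact CohLaplace.tendsto_laplaceForm f hVopen hA hΞ x
  · obtain ⟨hσA, hd⟩ := hγ.2 σ hσ
    refine (CohLaplace.integrableOn_simplexIntegrand f hVopen hA hσA hd
      (CohLaplace.continuous_expCoeff f (CohLaplace.realPoint x))
      fun ξ => (CohLaplace.norm_expCoeff_realPoint f x ξ).le).congr_fun (fun u hu => ?_)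
      (CohLaplace.isCompact_cornerSimplex q).measurableSet
    simp only [CohLaplace.simplexIntegrand, hbv x (CohLaplace.inCoords_mem hσA hu)]
    rfl
  · have hc' : (c : ℂ) ≠ 0 := Int.cast_ne_zero.2 hc
    rw [CohLaplace.boundaryMap, CohLaplace.chainIntegral_congr hγ (hbv x),
      CohLaplace.chainIntegral_laplaceForm_realPoint hVopen hA hγ hcγ f x,
      CohLaplace.setIntegral_expCoeff_eq_fourierInt hVopen hVbd f hf x,
      inv_mul_cancel_left₀ hc']
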